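/- **Setting.** Let $\mathcal D$ be a Fréchet space, densely embedded in a Hilbert space $\mathcal H$, whose topology is given by an increasing sequence of Hilbertian norms dominating the norm of $\mathcal H$; let $\mathcal E\subseteq\mathcal K$ be another such pair, with norms $\|\cdot\|(\xi)$, $\xi\in\mathbb N$. Tensor products of $\mathcal D$ with other locally convex spaces are completed projective ones; $\mathcal D_\bullet=\mathcal D\otimes\mathcal E$. $\mathcal B(V)$ denotes the continuous sesquilinear forms on $V$ (antilinear on the left, written $\langle x|Zy\rangle$) with the w*-topology induced by the predual $\overline V\otimes V$; $Z\ge 0$ means $\langle x|Zx\rangle\ge0$ for all $x$. Let $\mathfrak E$ be the space of $\mathcal E$-valued functions on $\mathbb R_+$ which are square-integrable in all norms $\|\cdot\|(\xi)$, let $\mathfrak F$ be the Fock space, the completion of the span of the coherent vectors $f^\otimes$, $f\in\mathfrak E$, in the norms $\|f^\otimes\|^2(\xi)=\exp\int_0^\infty\|f(t)\|^2(\xi)\,dt$, and put $\mathfrak D=\mathcal D\otimes\mathfrak F$, $\psi_f=\eta\otimes f^\otimes$, $\psi'_h=\eta'\otimes h^\otimes$ for $\eta,\eta'\in\mathcal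 D$. Write $f_{t]}=f1_{[0,t)}$ and $(f_{+r})(s)=f(r+s)$. Let $\mathcal A$ be a $*$-algebra of continuous operators on $\mathcal D$, $\mathcal A^c\subseteq\mathcal B(\mathcal D)$ its commutant, and $\mathcal B\subseteq\mathcal L(\mathcal H)$ a unital $*$-algebra of bounded operators contained and w*-dense in $\mathcal A^c$. Let $\mathfrak a$ be an Itô algebra, that is a $\star$-subalgebra, containing the death $d$ ($d^-_+=1$, other entries $0$), of the Hudson–Parthasarathy algebra of quadruples $\boldsymbol a=(a^\mu_\nu)^{\mu=-,\bullet}_{\nu=+,\bullet}$ over $\mathcal E$ (with adjoints), with product $(a^\mu_\bullet b^\bullet_\nu)$, such that for all $a\in\mathfrak a$ and $\zeta$ there is $\xi$ with $\|e+a^\bullet_\bullet e\|(\zeta)\le\|e\|(\xi)$ for all $e\in\mathcal E$. Let $\mathfrak B\subseteq\mathcal B(\mathfrak D)$ be the space of forms commuting with all $A\otimes I$, $A\in\mathcal A$, and all $I\otimes W(t,a)$, $t>0$, $a\in\mathfrak a$, where $W(t,a)f^\otimes=\exp\big[\int_0^t(a^-_\bullet f(r)+a^-_+)dr\big]\,g^\otimes$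 with $g(r)=f(r)+a^\bullet_\bullet f(r)+a^\bullet_+$ for $r<t$, $g(r)=f(r)$ for $r\ge t$, and $W(t,a)^\dagger=W(t,a^\star)$. The vacuum conditional expectation $\epsilon_t(Z)$ is the form with $\langle\psi_f|\epsilon_t(Z)\psi'_h\rangle=\langle\eta\otimes f_{t]}^\otimes|Z\,\eta'\otimes h_{t]}^\otimes\rangle\exp\int_t^\infty\langle f(r)|h(r)\rangle dr$, and $Z$ is adapted at time $t$ if $\epsilon_t(Z)=Z$. A *CP flow* is a family of linear w*-continuous maps $\phi_t:\mathcal B\to\mathfrak B$, $t\ge0$ (extended w*-continuously to $\mathcal A^c$), such that each $\phi_t(B)$ is adapted at time $t$; for $t>0$, $[\phi_t(B_{kl})]\ge0$ for every positive matrix $[B_{kl}]\ge0$ over $\mathcal B$; and for $r,s>0$ the cocycle condition $\langle\psi_f|\phi_{r+s}(B)\psi'_h\rangle=\langle\eta\otimes f_{r]}^\otimes|\phi_r(Y)\,\eta'\otimes h_{r]}^\otimes\rangle$ holds, where $Y\in\mathcal A^c$ is the form $\langle\xi|Y\xi'\rangle=\langle\xi\otimes f_{+r}^\otimes|\phi_s(B)\,\xi'\otimes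 h_{+r}^\otimes\rangle$. It *satisfies the quantum stochastic equation* $d\phi_t(B)=\phi_t(\lambda^\mu_\nu(B))\,d\Lambda^\nu_\mu$, $\phi_0(B)=B\otimes I$, with generator $\boldsymbol\lambda=(\lambda^\mu_\nu)^{\mu=-,\bullet}_{\nu=+,\bullet}$, a linear w*-continuous map $\mathcal B\to\mathcal B(\mathcal D\oplus\mathcal D_\bullet)$, if $t\mapsto\phi_t(B)$ is weakly continuous, the forms $\lambda(\bar e,B,e')=\lambda^-_+(B)+\bar e\lambda^\bullet_+(B)+\lambda^-_\bullet(B)e'+\bar e\lambda^\bullet_\bullet(B)e'$ lie in $\mathcal A^c$ for $e,e'\in\mathcal E$, and for all $f,h\in\mathfrak E$, $\eta,\eta'\in\mathcal D$, $B\in\mathcal B$ $$\frac{d}{dt}\langle\psi_f|\phi_t(B)\psi'_h\rangle=\langle\psi_f|\phi_t\big(\lambda(\bar f(t),B,h(t))\big)\psi'_h\rangle$$ at all $t\ge0$ at which $f$ and $h$ are continuous (one-sided at $t=0$). With $R_t=\phi_t(I)$, the flow is *subfiltering* if $(R_t)$ is a submartingale in the sense that $R_t\ge0$ is adapted and $\epsilon_t(R_s)\le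 R_t$ for $s\ge t\ge 0$, and $R_0=I$; it is *contractive* if $I\ge R_t\ge R_s$ for all $0\le t\le s$. **Theorem.** Let $\phi$ be a CP flow over $\mathcal B$ satisfying the quantum stochastic equation with generator $\boldsymbol\lambda$ and $\phi_0(B)=B\otimes I$. Let $\boldsymbol\gamma(B)=\boldsymbol\lambda(B)+\boldsymbol\imath(B)$ be its germ matrix, where $\imath^\mu_\nu(B)=B\delta^\mu_\nu$, i.e. $\gamma^-_+=\lambda^-_+$, $\gamma^\bullet_+=\lambda^\bullet_+$, $\gamma^-_\bullet=\lambda^-_\bullet$, $\gamma^\bullet_\bullet(B)=\lambda^\bullet_\bullet(B)+B\otimes\delta^\bullet_\bullet$, and let $\boldsymbol\iota(B)=B\oplus0$ be the degenerate representation. Then: 1. $\boldsymbol\gamma$ is conditionally completely positive with respect to $\boldsymbol\iota$: for every finitely supported family $(\boldsymbol\zeta_B)_{B\in\mathcal B}$ in $\mathcal D\oplus\mathcal D_\bullet$, $$\sum_{B}\boldsymbol\iota(B)\boldsymbol\zeta_B=0\ \Longrightarrow\ \sum_{B,C}\langle\boldsymbol\zeta_B|\boldsymbol\gamma(B^*C)\boldsymbol\zeta_C\rangle\ge0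 .$$ 2. $\gamma^-_+(B^*)=\gamma^-_+(B)^*$, $\gamma^\bullet_+(B^*)=\gamma^-_\bullet(B)^*$ and $\gamma^\bullet_\bullet(B^*)=\gamma^\bullet_\bullet(B)^*$ for all $B\in\mathcal B$ (Hermitian adjoints of forms). 3. If $\phi$ is subfiltering, then $-\lambda^-_+(I)\ge0$ as a form on $\mathcal D$. 4. If $\phi$ is contractive, then $-\boldsymbol\lambda(I)\ge0$ as a form on $\mathcal D\oplus\mathcal D_\bullet$. -/

import Mathlib

open MeasureTheory Set Filter Topology TensorProduct UniformSpace
open scoped ComplexConjugate ComplexOrder InnerProductSpace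

namespace QCP

noncomputable section

/-! ### Hilbertian scales

A pre-Hilbert Fréchet space `V ⊆ H`, given as the projective limit of an increasing sequence of
Hilbertian norms which dominate the norm of `H`. -/

/-- `V` is a dense subspace of the Hilbert space `H` (through the injection `emb`), and its topology
is the projective limit topology of an increasing sequence of Hilbertian norms (the norms of the
inner products `core p`), all of them dominating the norm of `H`. -/
structure HilbertianScale (V H : Type*) [AddCommGroup V] [Module ℂ V] [tV : TopologicalSpace V]
    [NormedAddCommGroup H] [InnerProductSpace ℂ H] where
  emb : V →ₗ[ℂ] H
  emb_injective : Function.Injective emb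
  emb_denseRange : DenseRange emb
  core : ℕ → InnerProductSpace.Core ℂ V
  norm_emb_sq_le : ∀ (p : ℕ) (x : V), ‖emb x‖ ^ 2 ≤ ((core p).inner x x).re
  mono : ∀ (p : ℕ) (x : V), ((core p).inner x x).re ≤ ((core (p + 1)).inner x x).re
  topology_eq : tV = ⨅ p : ℕ, (@InnerProductSpace.Core.toNormedAddCommGroup ℂ V _ _ _
    (core p)).toMetricSpace.toUniformSpace.toTopologicalSpace

section Scale

variable {V H : Type*} [AddCommGroup V] [Module ℂ V] [TopologicalSpace V]
  [NormedAddCommGroup H] [InnerProductSpace ℂ H]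

/-- The space `V` with the `p`-th Hilbertian norm of the scale. -/
def HilbertianScale.Lvl (_S : HilbertianScale V H) (_p : ℕ) : Type _ := V

instance (S : HilbertianScale V H) (p : ℕ) : NormedAddCommGroup (S.Lvl p) :=
  @InnerProductSpace.Core.toNormedAddCommGroup ℂ V _ _ _ (S.core p)

instance (S : HilbertianScale V H) (p : ℕ) : InnerProductSpace ℂ (S.Lvl p) :=
  InnerProductSpace.ofCore (S.core p).toCore

/-- The identity map from `V` to its `p`-th level. -/
def HilbertianScale.toLvl (S : HilbertianScale V H) (p : ℕ) : V →ₗ[ℂ] S.Lvl p :=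
  (LinearMap.id : V →ₗ[ℂ] V)

theorem HilbertianScale.continuous_toLvl (S : HilbertianScale V H) (p : ℕ) :
    Continuous (S.toLvl p) := by
  refine continuous_iff_le_induced.2 (S.topology_eq.le.trans ((iInf_le _ p).trans ?_))
  exact continuous_iff_le_induced.1 (continuous_id (X := S.Lvl p))

theorem HilbertianScale.norm_emb_le (S : HilbertianScale V H) (p : ℕ) (x : V) :
    ‖S.emb x‖ ≤ ‖S.toLvl p x‖ := by
  have h : ‖S.toLvl p x‖ ^ 2 = ((S.core p).inner x x).re :=
    norm_sq_eq_re_inner (𝕜 := ℂ) (S.toLvl p x)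
  have := S.norm_emb_sq_le p x
  exact le_of_sq_le_sq (by linarith) (norm_nonneg _)

theorem HilbertianScale.continuous_emb (S : HilbertianScale V H) : Continuous S.emb := by
  let g : S.Lvl 0 →L[ℂ] H := LinearMap.mkContinuous (S.emb : S.Lvl 0 →ₗ[ℂ] H) 1
    (fun x => (S.norm_emb_le 0 x).trans (one_mul _).ge)
  exact g.continuous.comp (S.continuous_toLvl 0)

end Scale

/-! ### Continuous sesquilinear forms -/

section Forms

variable (V : Type*) {W : Type*} [AddCommGroup V] [Module ℂ V] [TopologicalSpace V]
  [AddCommGroup W] [Module ℂ W] [TopologicalSpace W]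

/-- The space `𝓑(V)` of all (jointly) continuous sesquilinear forms on `V`, antilinear in the first
argument. -/
def Form : Submodule ℂ (V →ₗ⋆[ℂ] V →ₗ[ℂ] ℂ) where
  carrier := {Z | Continuous fun x : V × V => Z x.1 x.2}
  add_mem' hY hZ := Continuous.add hY hZ
  zero_mem' := continuous_const
  smul_mem' c _ hZ := Continuous.const_smul hZ c

variable {V}

/-- Positivity of a form: `⟨x|Z x⟩ ≥ 0` (in particular real) for all `x`. -/
def IsNonneg (Z : Form V) : Prop := ∀ x : V, 0 ≤ Z.val x x

/-- The form `(x, y) ↦ ⟨S x|Z (T y)⟩`. -/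
def pullForm (S T : V →L[ℂ] W) (Z : Form W) : Form V :=
  ⟨LinearMap.mk₂'ₛₗ (starRingEnd ℂ) (RingHom.id ℂ) (fun x y => Z.1 (S x) (T y))
    (by intros; simp) (by intros; simp) (by intros; simp) (by intros; simp),
    Z.2.comp ((S.continuous.comp continuous_fst).prodMk (T.continuous.comp continuous_snd))⟩

/-- The inner product of a complex inner product space as a continuous form. -/
def innerForm (G : Type*) [NormedAddCommGroup G] [InnerProductSpace ℂ G] : Form G :=
  ⟨innerₛₗ ℂ, continuous_inner⟩

/-- The w*-topology on `𝓑(V)`, induced by the predual, the completed projective tensor product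
of (the conjugate of) `V` with `V`. The elements of this predual are the absolutely convergent
series `∑ xₙ ⊗ yₙ`, paired with a form `Z` as `∑ ⟨xₙ|Z yₙ⟩`. -/
@[reducible]
def wstar (V : Type*) [AddCommGroup V] [Module ℂ V] [TopologicalSpace V] :
    TopologicalSpace (Form V) :=
  ⨅ (x : ℕ → V) (y : ℕ → V) (_ : ∀ p q : Seminorm ℂ V, Continuous p → Continuous q →
      Summable fun n => p (x n) * q (y n)),
    TopologicalSpace.induced (fun Z : Form V => ∑' n, Z.val (x n) (y n)) inferInstance

end Forms

/-! ### Projective tensor products -/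

section Proj

variable (V W : Type*) [AddCommGroup V] [Module ℂ V] [TopologicalSpace V]
  [AddCommGroup W] [Module ℂ W] [TopologicalSpace W]

/-- The algebraic tensor product of two topological vector spaces, to be equipped with the
projective topology. -/
def ProjTensor : Type _ := V ⊗[ℂ] W

instance : AddCommGroup (ProjTensor V W) := inferInstanceAs (AddCommGroup (V ⊗[ℂ] W))

instance : Module ℂ (ProjTensor V W) := inferInstanceAs (Module ℂ (V ⊗[ℂ] W))

variable {V W} in
/-- The elementary tensor `v ⊗ w`, as a bilinear map. -/
def ptmul : V →ₗ[ℂ] W →ₗ[ℂ] ProjTensor V W := TensorProduct.mk ℂ V W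

/-- The vector space topologies which are locally convex and make `(v, w) ↦ v ⊗ w` continuous. -/
def IsAdmissible (t : TopologicalSpace (ProjTensor V W)) : Prop :=
  @IsTopologicalAddGroup _ t _ ∧ @ContinuousSMul ℂ _ _ _ t ∧
    @LocallyConvexSpace ℝ _ _ _ _ _ t ∧
    @Continuous (V × W) _ _ t fun x => ptmul x.1 x.2

/-- The projective topology: the finest locally convex topology which makes `(v, w) ↦ v ⊗ w`
continuous. -/
instance : TopologicalSpace (ProjTensor V W) := sInf {t | IsAdmissible V W t}

instance : IsTopologicalAddGroup (ProjTensor V W) := topologicalAddGroup_sInf fun _ ht => ht.1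

instance : ContinuousSMul ℂ (ProjTensor V W) := continuousSMul_sInf fun _ ht => ht.2.1

instance : UniformSpace (ProjTensor V W) := IsTopologicalAddGroup.rightUniformSpace _

instance : IsUniformAddGroup (ProjTensor V W) := isUniformAddGroup_of_addCommGroup

instance : UniformContinuousConstSMul ℂ (ProjTensor V W) :=
  uniformContinuousConstSMul_of_continuousConstSMul _ _

theorem continuous_ptmul :
    Continuous fun x : V × W => (ptmul x.1 x.2 : ProjTensor V W) :=
  continuous_sInf_rng.2 fun _ ht => ht.2.2.2

/-- The completed projective tensor product `V ⊗ W`. -/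
abbrev CProj : Type _ := Completion (ProjTensor V W)

variable {V W}

/-- The elementary tensor `v ⊗ w` in the completed projective tensor product. -/
def tens (v : V) (w : W) : CProj V W := ((ptmul v w : ProjTensor V W) : Completion _)

/-- The continuous linear operator `v ↦ v ⊗ w`. -/
def tensL (w : W) : V →L[ℂ] CProj V W where
  toFun v := tens v w
  map_add' v v' := by simp [tens, Completion.coe_add]
  map_smul' c v := by simp [tens, Completion.coe_smul]
  cont := (Completion.continuous_coe _).comp
    ((continuous_ptmul V W).comp (continuous_id.prodMk continuous_const))

/-- A bilinear map `B(v, w) = b (v ⊗ w)` which is jointly continuous, with values in a normed space,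
gives a continuous linear operator on the projective tensor product. -/
def ProjTensor.lift {N : Type*} [NormedAddCommGroup N] [NormedSpace ℂ N]
    (b : V ⊗[ℂ] W →ₗ[ℂ] N) (hb : Continuous fun x : V × W => b (x.1 ⊗ₜ[ℂ] x.2)) :
    ProjTensor V W →L[ℂ] N where
  toLinearMap := show ProjTensor V W →ₗ[ℂ] N from b
  cont := by
    let b' : ProjTensor V W →ₗ[ℂ] N := b
    change Continuous b'
    refine continuous_iff_le_induced.2 (sInf_le ⟨?_, ?_, ?_, ?_⟩)
    · exact topologicalAddGroup_induced b'
    · exact continuousSMul_induced b'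
    · exact LocallyConvexSpace.induced (b'.restrictScalars ℝ)
    · exact continuous_induced_rng.2 hb

end Proj

/-! ### Test functions and the Fock space -/

section Fock

variable {E K : Type*} [AddCommGroup E] [Module ℂ E] [TopologicalSpace E]
  [NormedAddCommGroup K] [InnerProductSpace ℂ K]

/-- The space `𝔈` of square-integrable `E`-valued functions on `ℝ₊ = [0, ∞)`: all Hilbertian norms
are square-integrable. (The values at negative times are irrelevant.) -/
structure TestFun (S : HilbertianScale E K) where
  toFun : ℝ → E
  memLp : ∀ ξ : ℕ, MemLp (fun t => S.toLvl ξ (toFun t)) 2 (volume.restrict (Ici (0 : ℝ)))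

namespace TestFun

variable {S : HilbertianScale E K}

/-- The class of `f` in the Hilbert space `L²(ℝ₊)` with respect to the `ξ`-th norm. -/
def toL2 (ξ : ℕ) (f : TestFun S) : Lp (S.Lvl ξ) 2 (volume.restrict (Ici (0 : ℝ))) :=
  (f.memLp ξ).toLp _

/-- The integral `∫_t^∞ ⟨f(r)|h(r)⟩ dr` of the inner product of `K`. -/
def innerFrom (t : ℝ) (f h : TestFun S) : ℂ :=
  ∫ r in Ici t, ⟪S.emb (f.toFun r), S.emb (h.toFun r)⟫_ℂ

/-- The restriction of `f` to `[0, t)`, extended by zero. -/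
def trunc (t : ℝ) (f : TestFun S) : TestFun S where
  toFun := (Iio t).indicator f.toFun
  memLp ξ := by
    have h := (f.memLp ξ).indicator (measurableSet_Iio (a := t))
    have e : (fun r => S.toLvl ξ ((Iio t).indicator f.toFun r)) =
        (Iio t).indicator fun r => S.toLvl ξ (f.toFun r) := by
      funext r
      by_cases hr : r ∈ Iio t
      · rw [indicator_of_mem hr, indicator_of_mem hr]
      · rw [indicator_of_notMem hr, indicator_of_notMem hr, map_zero]
    rw [e]
    exact h

/-- The shifted function `r ↦ f(t + r)`. -/
def shift (t : ℝ) (ht : 0 ≤ t) (f : TestFun S) : TestFun S where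
  toFun r := f.toFun (t + r)
  memLp ξ := by
    have h1 : MemLp (fun r => S.toLvl ξ (f.toFun r)) 2 (volume.restrict (Ici t)) :=
      (f.memLp ξ).mono_measure (Measure.restrict_mono (Ici_subset_Ici.2 ht) le_rfl)
    have h2 := (measurePreserving_add_left volume t).restrict_preimage
      (measurableSet_Ici (a := t))
    have h3 := h1.comp_measurePreserving h2
    have h4 : (fun x => t + x) ⁻¹' Ici t = Ici (0 : ℝ) := by ext x; simp
    rw [h4] at h3
    exact h3

end TestFun

/-- The exponential kernel of a family of vectors in an inner product space is positive
semidefinite. -/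
theorem posSemidef_exp {X G : Type*} [NormedAddCommGroup G] [InnerProductSpace ℂ G] (v : X → G) :
    (Matrix.of fun x y => Complex.exp ⟪v x, v y⟫_ℂ).PosSemidef := by
  have hgram : (Matrix.of fun x y => ⟪v x, v y⟫_ℂ).PosSemidef := by
    refine ⟨by ext x y; simp [Matrix.conjTranspose_apply], fun a => ?_⟩
    have h : (a.sum fun x ax => a.sum fun y b_y => star ax * ⟪v x, v y⟫_ℂ * b_y) =
        ⟪∑ x ∈ a.support, a x • v x, ∑ y ∈ a.support, a y • v y⟫_ℂ := by
      simp only [Finsupp.sum, sum_inner, inner_sum, inner_smul_left, inner_smul_right,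
        Finset.mul_sum]
      rw [Finset.sum_comm]
      refine Finset.sum_congr rfl fun x _ => Finset.sum_congr rfl fun y _ => ?_
      rw [starRingEnd_apply]
      ring
    simp only [Matrix.of_apply]
    rw [h]
    rw [inner_self_eq_norm_sq_to_K, ← RCLike.ofReal_pow]
    exact Complex.zero_le_real.2 (sq_nonneg _)
  have hpow : ∀ n : ℕ, (Matrix.of fun x y => ⟪v x, v y⟫_ℂ ^ n).PosSemidef := by
    intro n
    induction n with
    | zero =>
      refine ⟨by ext x y; simp [Matrix.conjTranspose_apply], fun a => ?_⟩
      have h : (a.sum fun x ax => a.sum fun y b_y => star ax * ⟪v x, v y⟫_ℂ ^ 0 * b_y) =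
          star (∑ x ∈ a.support, a x) * ∑ y ∈ a.support, a y := by
        simp only [Finsupp.sum, pow_zero, mul_one, star_sum, Finset.sum_mul, Finset.mul_sum]
        rw [Finset.sum_comm]
      simp only [Matrix.of_apply]
      rw [h]
      exact star_mul_self_nonneg _
    | succ n ih => exact ih.hadamard hgram
  refine ⟨?_, fun a => ?_⟩
  · ext x y
    simp [Matrix.conjTranspose_apply, ← Complex.exp_conj]
  · have hs : HasSum (fun n : ℕ => ((n.factorial : ℂ)⁻¹) *
        a.sum fun x ax => a.sum fun y b_y => star ax * ⟪v x, v y⟫_ℂ ^ n * b_y)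
        (a.sum fun x ax => a.sum fun y b_y => star ax * Complex.exp ⟪v x, v y⟫_ℂ * b_y) := by
      simp only [Finsupp.sum, Finset.mul_sum]
      refine hasSum_sum fun x _ => hasSum_sum fun y _ => ?_
      have h := ((NormedSpace.expSeries_div_hasSum_exp (𝔸 := ℂ) ⟪v x, v y⟫_ℂ).mul_left
        (star (a x))).mul_right (a y)
      rw [← Complex.exp_eq_exp_ℂ] at h
      have e : (fun n : ℕ => ((n.factorial : ℂ)⁻¹) * (star (a x) * ⟪v x, v y⟫_ℂ ^ n * a y)) =
          fun n : ℕ => star (a x) * (⟪v x, v y⟫_ℂ ^ n / (n.factorial : ℂ)) * a y := by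
        funext n
        rw [div_eq_mul_inv]
        ring
      rw [e]
      exact h
    refine hs.nonneg fun n => mul_nonneg ?_ ((hpow n).2 a)
    rw [← Complex.ofReal_natCast, ← Complex.ofReal_inv]
    exact Complex.zero_le_real.2 (by positivity)

/-- The pre-inner product `(∑ a_x x | ∑ b_y y) = ∑ conj(a_x) b_y exp ⟨v x|v y⟩` on formal linear
combinations. -/
@[reducible]
def expCore {X G : Type*} [NormedAddCommGroup G] [InnerProductSpace ℂ G] (v : X → G) :
    PreInnerProductSpace.Core ℂ (X →₀ ℂ) where
  inner a b := a.sum fun x ax => b.sum fun y b_y => conj ax * Complex.exp ⟪v x, v y⟫_ℂ * b_y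
  conj_inner_symm a b := by
    simp only [Finsupp.sum, map_sum, map_mul, Complex.conj_conj, ← Complex.exp_conj,
      inner_conj_symm]
    rw [Finset.sum_comm]
    refine Finset.sum_congr rfl fun x _ => Finset.sum_congr rfl fun y _ => by ring
  re_inner_nonneg a := (Complex.nonneg_iff.1 ((posSemidef_exp v).2 a)).1
  add_left a b c := by
    refine Finsupp.sum_add_index' (by simp) fun x s t => ?_
    simp [Finsupp.sum, add_mul, Finset.sum_add_distrib]
  smul_left a b r := by
    rw [Finsupp.sum_smul_index (by simp)]
    simp only [Finsupp.sum, Finset.mul_sum, map_mul]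
    refine Finset.sum_congr rfl fun x _ => Finset.sum_congr rfl fun y _ => by ring

/-- The linear span of the coherent vectors `f^⊗`, `f ∈ 𝔈`, as formal linear combinations. -/
def CohSpan (S : HilbertianScale E K) : Type _ := TestFun S →₀ ℂ

instance (S : HilbertianScale E K) : AddCommGroup (CohSpan S) :=
  inferInstanceAs (AddCommGroup (TestFun S →₀ ℂ))

instance (S : HilbertianScale E K) : Module ℂ (CohSpan S) :=
  inferInstanceAs (Module ℂ (TestFun S →₀ ℂ))

/-- The span of the coherent vectors with its `ξ`-th Hilbertian seminorm, given by
`(f^⊗ | h^⊗)(ξ) = exp (f | h)(ξ)`, where `(f | h)(ξ)` is the scalar product of `L²(ℝ₊)` with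
respect to the `ξ`-th norm. -/
def CohLvl (S : HilbertianScale E K) (_ξ : ℕ) : Type _ := TestFun S →₀ ℂ

instance (S : HilbertianScale E K) (ξ : ℕ) : SeminormedAddCommGroup (CohLvl S ξ) :=
  @InnerProductSpace.Core.toSeminormedAddCommGroup ℂ (TestFun S →₀ ℂ) _ _ _
    (expCore (TestFun.toL2 (S := S) ξ))

instance (S : HilbertianScale E K) (ξ : ℕ) : InnerProductSpace ℂ (CohLvl S ξ) :=
  InnerProductSpace.ofCore (expCore (TestFun.toL2 (S := S) ξ))

/-- The identity map from the span of the coherent vectors to its `ξ`-th level. -/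
def CohSpan.toLvl (S : HilbertianScale E K) (ξ : ℕ) : CohSpan S →ₗ[ℂ] CohLvl S ξ :=
  (LinearMap.id : (TestFun S →₀ ℂ) →ₗ[ℂ] (TestFun S →₀ ℂ))

instance (S : HilbertianScale E K) : UniformSpace (CohSpan S) :=
  ⨅ ξ : ℕ, UniformSpace.comap (CohSpan.toLvl S ξ) inferInstance

instance (S : HilbertianScale E K) : IsUniformAddGroup (CohSpan S) :=
  isUniformAddGroup_iInf fun ξ => IsUniformAddGroup.comap (CohSpan.toLvl S ξ)

instance (S : HilbertianScale E K) : UniformContinuousConstSMul ℂ (CohSpan S) where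
  uniformContinuous_const_smul c := by
    refine uniformContinuous_iInf_rng.2 fun ξ => uniformContinuous_iInf_dom (i := ξ) ?_
    let _ : UniformSpace (CohSpan S) := UniformSpace.comap (CohSpan.toLvl S ξ) inferInstance
    have h : UniformContinuous fun x : CohSpan S => c • CohSpan.toLvl S ξ x :=
      (uniformContinuous_const_smul c).comp uniformContinuous_comap
    exact uniformContinuous_comap' h

/-- The Fock space `𝔉`: the completion of the span of the coherent vectors with respect to all the
norms `‖f^⊗‖²(ξ) = exp ‖f‖²(ξ)`, that is the projective limit of the Fock spaces over the
completions of `𝔈`. -/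
abbrev Fock (S : HilbertianScale E K) : Type _ := Completion (CohSpan S)

/-- The coherent vector `f^⊗`. -/
def coh {S : HilbertianScale E K} (f : TestFun S) : Fock S :=
  ((show CohSpan S from Finsupp.single f 1 : CohSpan S) : Completion (CohSpan S))

end Fock

/-! ### Itô algebras and their exponential operators -/

section Ito

variable {E K : Type*} [AddCommGroup E] [Module ℂ E] [TopologicalSpace E]
  [NormedAddCommGroup K] [InnerProductSpace ℂ K]

/-- A quadruple of the Hudson--Parthasarathy algebra: `exch = a^•_• : E → E` with adjoint
`exchAdj`, `cre = a^•_+ ∈ E`, `a^-_• = ⟨ann|·⟩` with `ann ∈ E`, and `time = a^-_+ ∈ ℂ`. -/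
structure HPQuad (S : HilbertianScale E K) where
  exch : E →L[ℂ] E
  exchAdj : E →L[ℂ] E
  adj : ∀ e e' : E, ⟪S.emb (exchAdj e), S.emb e'⟫_ℂ = ⟪S.emb e, S.emb (exch e')⟫_ℂ
  cre : E
  ann : E
  time : ℂ

namespace HPQuad

variable {S : HilbertianScale E K}

/-- The involution `a ↦ a⋆`. -/
def star (a : HPQuad S) : HPQuad S where
  exch := a.exchAdj
  exchAdj := a.exch
  adj e e' := by rw [← inner_conj_symm, ← a.adj, inner_conj_symm]
  cre := a.ann
  ann := a.cre
  time := conj a.time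

/-- The death `d`, with `d^-_+ = 1` as its only non-zero entry. -/
def death : HPQuad S where
  exch := 0
  exchAdj := 0
  adj := by simp
  cre := 0
  ann := 0
  time := 1

/-- The Hudson--Parthasarathy product `a • b = (a^μ_• b^•_ν)`. -/
def mul (a b : HPQuad S) : HPQuad S where
  exch := a.exch.comp b.exch
  exchAdj := b.exchAdj.comp a.exchAdj
  adj e e' := by simp [b.adj, a.adj]
  cre := a.exch b.cre
  ann := b.exchAdj a.ann
  time := ⟪S.emb a.ann, S.emb b.cre⟫_ℂ

variable [IsTopologicalAddGroup E] [ContinuousSMul ℂ E]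

def add (a b : HPQuad S) : HPQuad S where
  exch := a.exch + b.exch
  exchAdj := a.exchAdj + b.exchAdj
  adj e e' := by
    simp only [add_apply, map_add, inner_add_left, inner_add_right, a.adj, b.adj]
  cre := a.cre + b.cre
  ann := a.ann + b.ann
  time := a.time + b.time

def smul (c : ℂ) (a : HPQuad S) : HPQuad S where
  exch := c • a.exch
  exchAdj := conj c • a.exchAdj
  adj e e' := by
    simp only [smul_apply, map_smul, inner_smul_left, inner_smul_right, a.adj,
      Complex.conj_conj]
  cre := c • a.cre
  ann := conj c • a.ann
  time := c * a.time

end HPQuad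

variable [IsTopologicalAddGroup E] [ContinuousSMul ℂ E]

/-- An Itô algebra: a `⋆`-subalgebra of the Hudson--Parthasarathy algebra of quadruples which
contains the death, such that all the operators `1 + a^•_•` are projective contractions. -/
structure ItoAlgebra (S : HilbertianScale E K) where
  carrier : Set (HPQuad S)
  death_mem : HPQuad.death ∈ carrier
  add_mem : ∀ a ∈ carrier, ∀ b ∈ carrier, a.add b ∈ carrier
  smul_mem : ∀ (c : ℂ), ∀ a ∈ carrier, a.smul c ∈ carrier
  mul_mem : ∀ a ∈ carrier, ∀ b ∈ carrier, a.mul b ∈ carrier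
  star_mem : ∀ a ∈ carrier, a.star ∈ carrier
  contraction : ∀ a ∈ carrier, ∀ ζ : ℕ, ∃ ξ : ℕ, ∀ e : E,
    ‖S.toLvl ζ (e + a.exch e)‖ ≤ ‖S.toLvl ξ e‖

variable {S : HilbertianScale E K}

/-- The test function `g` with `g(r) = f(r) + a^•_• f(r) + a^•_+` for `r < t` and `g(r) = f(r)` for
`r ≥ t`. The exponential operator `W(t, a)` is determined by
`W(t, a) f^⊗ = exp (∫_0^t (a^-_• f(r) + a^-_+) dr) g^⊗`. -/
def weylFun (𝔞 : ItoAlgebra S) (t : ℝ) (a : 𝔞.carrier) (f : TestFun S) : TestFun S where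
  toFun := (Iio t).piecewise (fun r => f.toFun r + a.1.exch (f.toFun r) + a.1.cre) f.toFun
  memLp ζ := by
    obtain ⟨ξ, hξ⟩ := 𝔞.contraction a.1 a.2 ζ
    let T : S.Lvl ξ →L[ℂ] S.Lvl ζ := LinearMap.mkContinuous
      (show S.Lvl ξ →ₗ[ℂ] S.Lvl ζ from
        (LinearMap.id + a.1.exch.toLinearMap : E →ₗ[ℂ] E)) 1
      (fun e => (hξ e).trans (one_mul _).ge)
    have h1 : MemLp (fun r => S.toLvl ζ (f.toFun r + a.1.exch (f.toFun r))) 2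
        (volume.restrict (Ici (0 : ℝ))) := T.comp_memLp' (f.memLp ξ)
    have h2 : MemLp ((Ico 0 t).indicator fun _ : ℝ => S.toLvl ζ a.1.cre) 2
        (volume.restrict (Ici (0 : ℝ))) :=
      ((memLp_indicator_const 2 measurableSet_Ico _ (Or.inr measure_Ico_lt_top.ne)).restrict _)
    have h3 := ((h1.add h2).indicator (measurableSet_Iio (a := t))).add
      ((f.memLp ζ).indicator (measurableSet_Iio (a := t)).compl)
    refine h3.ae_eq ?_
    filter_upwards [ae_restrict_mem (measurableSet_Ici (a := (0 : ℝ)))] with r hr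
    by_cases hrt : r ∈ Iio t
    · have h4 : r ∈ Ico 0 t := ⟨hr, hrt⟩
      simp only [Pi.add_apply]
      rw [indicator_of_mem hrt, indicator_of_notMem (notMem_compl_iff.2 hrt), piecewise_eq_of_mem _ _ _ hrt,
        Pi.add_apply, indicator_of_mem h4, add_zero, map_add _ (_ + _)]
    · simp only [Pi.add_apply]
      rw [indicator_of_notMem hrt, indicator_of_mem (by exact hrt),
        piecewise_eq_of_notMem _ _ _ hrt, zero_add]

/-- The factor `exp (∫_0^t (a^-_• f(r) + a^-_+) dr)`. -/
def weylFactor (t : ℝ) (a : HPQuad S) (f : TestFun S) : ℂ :=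
  Complex.exp (∫ r in Ico 0 t, (⟪S.emb a.ann, S.emb (f.toFun r)⟫_ℂ + a.time))

end Ito

/-! ### The algebras of the system -/

section System

variable {D H E K : Type*}
  [NormedAddCommGroup H] [InnerProductSpace ℂ H] [NormedAddCommGroup K] [InnerProductSpace ℂ K]
  [AddCommGroup D] [Module ℂ D] [TopologicalSpace D] [IsTopologicalAddGroup D]
  [ContinuousSMul ℂ D]
  [AddCommGroup E] [Module ℂ E] [TopologicalSpace E] [IsTopologicalAddGroup E]
  [ContinuousSMul ℂ E]

/-- `A'` is the Hermitian adjoint `A†` of the operator `A` on `D`. -/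
def IsHermAdj (SD : HilbertianScale D H) (A A' : D →L[ℂ] D) : Prop :=
  ∀ η η' : D, ⟪SD.emb (A' η), SD.emb η'⟫_ℂ = ⟪SD.emb η, SD.emb (A η')⟫_ℂ

/-- An operator `*`-algebra `𝒜` of continuous operators on `D`. -/
structure OpStarAlgebra (SD : HilbertianScale D H) where
  alg : NonUnitalSubalgebra ℂ (D →L[ℂ] D)
  star_mem : ∀ A ∈ alg, ∃ A' ∈ alg, IsHermAdj SD A A'

/-- The commutant `𝒜ᶜ` of `𝒜` in the space of continuous sesquilinear forms on `D`. -/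
def commutant {SD : HilbertianScale D H} (𝒜 : OpStarAlgebra SD) : Submodule ℂ (Form D) where
  carrier := {Y | ∀ A ∈ 𝒜.alg, ∀ A', IsHermAdj SD A A' →
    ∀ η η' : D, Y.val (A' η) η' = Y.val η (A η')}
  add_mem' hY hZ A hA A' h η η' :=
    congrArg₂ (· + ·) (hY A hA A' h η η') (hZ A hA A' h η η')
  zero_mem' _ _ _ _ _ _ := rfl
  smul_mem' c _ hY A hA A' h η η' := congrArg (c * ·) (hY A hA A' h η η')

/-- The space `𝔇 = 𝓓 ⊗ 𝔉`. -/
abbrev BigD (D : Type*) [AddCommGroup D] [Module ℂ D] [TopologicalSpace D]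
    (SE : HilbertianScale E K) : Type _ := CProj D (Fock SE)

/-- The operator `η ↦ ψ_f = η ⊗ f^⊗`. -/
def prodVec {SE : HilbertianScale E K} (f : TestFun SE) : D →L[ℂ] BigD D SE := tensL (coh f)

/-- The space `𝔅` of all continuous sesquilinear forms on `𝔇` which commute with `A ⊗ I` for all
`A ∈ 𝒜` and with `I ⊗ W(t, a)` for all `t > 0` and `a ∈ 𝔞`. As `W(t, a)† = W(t, a⋆)`, the latter
says that `⟨ψ_f|Y W(t, a) ψ_h⟩ = ⟨W(t, a⋆) ψ_f|Y ψ_h⟩` on the (total) product vectors. -/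
def bigB {SD : HilbertianScale D H} {SE : HilbertianScale E K} (𝒜 : OpStarAlgebra SD)
    (𝔞 : ItoAlgebra SE) : Submodule ℂ (Form (BigD D SE)) where
  carrier := {Y |
    (∀ A ∈ 𝒜.alg, ∀ A', IsHermAdj SD A A' → ∀ (η η' : D) (ϕ ϕ' : Fock SE),
      Y.val (tens (A' η) ϕ) (tens η' ϕ') = Y.val (tens η ϕ) (tens (A η') ϕ')) ∧
    ∀ t : ℝ, 0 < t → ∀ a : 𝔞.carrier, ∀ (η η' : D) (f h : TestFun SE),
      weylFactor t a.1 h * Y.val (prodVec f η) (prodVec (weylFun 𝔞 t a h) η') =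
        conj (weylFactor t a.1.star f) *
          Y.val (prodVec (weylFun 𝔞 t ⟨a.1.star, 𝔞.star_mem a.1 a.2⟩ f) η) (prodVec h η')}
  add_mem' {Y Z} hY hZ := by
    refine ⟨fun A hA A' h η η' ϕ ϕ' => congrArg₂ (· + ·) (hY.1 A hA A' h η η' ϕ ϕ')
      (hZ.1 A hA A' h η η' ϕ ϕ'), fun t ht a η η' f h => ?_⟩
    have h1 := hY.2 t ht a η η' f h
    have h2 := hZ.2 t ht a η η' f h
    have h3 : ∀ x y, (Y + Z).val x y = Y.val x y + Z.val x y := fun _ _ => rfl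
    rw [h3, h3, mul_add, mul_add, h1, h2]
  zero_mem' := by
    refine ⟨fun _ _ _ _ _ _ _ _ => rfl, fun t ht a η η' f h => ?_⟩
    have h3 : ∀ x y, (0 : Form (BigD D SE)).val x y = 0 := fun _ _ => rfl
    rw [h3, h3, mul_zero, mul_zero]
  smul_mem' c Y hY := by
    refine ⟨fun A hA A' h η η' ϕ ϕ' => congrArg (c * ·) (hY.1 A hA A' h η η' ϕ ϕ'),
      fun t ht a η η' f h => ?_⟩
    have h1 := hY.2 t ht a η η' f h
    have h3 : ∀ x y, (c • Y).val x y = c * Y.val x y := fun _ _ => rfl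
    rw [h3, h3, mul_left_comm, h1, mul_left_comm]

/-- The coherent matrix element `Y(f̄, h) = F* Y H`, that is `⟨η|Y(f̄, h) η'⟩ = ⟨ψ_f|Y ψ'_h⟩`. -/
def cohElement {SE : HilbertianScale E K} (Y : Form (BigD D SE)) (f h : TestFun SE) : Form D :=
  pullForm (prodVec f) (prodVec h) Y

theorem cohElement_mem {SD : HilbertianScale D H} {SE : HilbertianScale E K}
    {𝒜 : OpStarAlgebra SD} {𝔞 : ItoAlgebra SE} (Y : bigB 𝒜 𝔞) (f h : TestFun SE) :
    cohElement Y.1 f h ∈ commutant 𝒜 :=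
  fun A hA A' hA' η η' => Y.2.1 A hA A' hA' η η' (coh f) (coh h)

/-- The form `⟨η|B η'⟩` on `D` of a bounded operator `B` on `H`. -/
def bddForm (SD : HilbertianScale D H) : (H →L[ℂ] H) →ₗ[ℂ] Form D where
  toFun B := pullForm ⟨SD.emb, SD.continuous_emb⟩ (B.comp ⟨SD.emb, SD.continuous_emb⟩) (innerForm H)
  map_add' B C := by
    apply Subtype.ext
    ext x y
    exact inner_add_right _ _ _
  map_smul' c B := by
    apply Subtype.ext
    ext x y
    exact inner_smul_right _ _ _

/-- The form `B ⊗ δ^•_•` on `D ⊗ E`, with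
`⟨η ⊗ e|(B ⊗ δ^•_•) (η' ⊗ e')⟩ = ⟨η|B η'⟩ ⟨e|e'⟩`. -/
def ampForm (SD : HilbertianScale D H) (SE : HilbertianScale E K) (B : H →L[ℂ] H) :
    Form (CProj D E) :=
  let J : (H →L[ℂ] H) → (ProjTensor D E →L[ℂ] H ⊗[ℂ] K) := fun C =>
    ProjTensor.lift (TensorProduct.map (C.toLinearMap ∘ₗ SD.emb) SE.emb) (by
      simp only [TensorProduct.map_tmul]
      exact TensorProduct.continuous_tmul.comp
        (((C.continuous.comp SD.continuous_emb).comp continuous_fst).prodMk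
          (SE.continuous_emb.comp continuous_snd)))
  pullForm (J (ContinuousLinearMap.id ℂ H)).completion (J B).completion
    (innerForm (Completion (H ⊗[ℂ] K)))

variable [CompleteSpace H]

/-- A unital `*`-algebra `𝓑 ⊆ 𝓛(H)` of bounded operators, w*-dense in the commutant `𝒜ᶜ`. -/
structure ObsAlgebra {SD : HilbertianScale D H} (𝒜 : OpStarAlgebra SD) where
  alg : StarSubalgebra ℂ (H →L[ℂ] H)
  mem : ∀ B : alg, bddForm SD B ∈ commutant 𝒜
  dense : ∀ Y ∈ commutant 𝒜, Y ∈ @closure _ (wstar D) (range fun B : alg => bddForm SD B)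

/-- The inclusion of `𝓑` into the commutant. -/
def ObsAlgebra.incl {SD : HilbertianScale D H} {𝒜 : OpStarAlgebra SD} (𝓑 : ObsAlgebra 𝒜) :
    𝓑.alg →ₗ[ℂ] commutant 𝒜 where
  toFun B := ⟨bddForm SD B, 𝓑.mem B⟩
  map_add' B C := by
    apply Subtype.ext
    exact map_add (bddForm SD) (B : H →L[ℂ] H) C
  map_smul' c B := by
    apply Subtype.ext
    exact map_smul (bddForm SD) c (B : H →L[ℂ] H)

end System

/-! ### Adaptedness, conditional expectations, martingales -/

section Adapted

variable {D H E K : Type*}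
  [NormedAddCommGroup H] [InnerProductSpace ℂ H] [NormedAddCommGroup K] [InnerProductSpace ℂ K]
  [AddCommGroup D] [Module ℂ D] [TopologicalSpace D]
  [AddCommGroup E] [Module ℂ E] [TopologicalSpace E]
  {SE : HilbertianScale E K}

/-- The form `M` is the vacuum conditional expectation `ε_t(Z)`: it is the adapted form which
coincides with `Z` on the product vectors `η ⊗ f^⊗` with `f` supported by `[0, t)`, and acts as the
identity on the Fock space over `[t, ∞)`. -/
def IsCondExp (t : ℝ) (Z M : Form (BigD D SE)) : Prop :=
  ∀ (η η' : D) (f h : TestFun SE),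
    M.val (prodVec f η) (prodVec h η') =
      Z.val (prodVec (f.trunc t) η) (prodVec (h.trunc t) η') * Complex.exp (f.innerFrom t h)

/-- The form `Z` is adapted at time `t`: it acts as the identity on the Fock space over `[t, ∞)`,
so that it is its own conditional expectation. -/
def IsAdapted (t : ℝ) (Z : Form (BigD D SE)) : Prop := IsCondExp t Z Z

/-- The form `Z` is the ampliation `Y ⊗ I` of a form `Y` on `D`. -/
def IsAmpliation (Y : Form D) (Z : Form (BigD D SE)) : Prop :=
  ∀ (η η' : D) (f h : TestFun SE),
    Z.val (prodVec f η) (prodVec h η') = Y.val η η' * Complex.exp (f.innerFrom 0 h)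

/-- Submartingales: adapted families of positive forms with `ε_t(M_s) ≤ M_t` for `s ≥ t ≥ 0`. -/
def IsSubmartingale (M : ℝ → Form (BigD D SE)) : Prop :=
  (∀ t, 0 ≤ t → IsAdapted t (M t) ∧ IsNonneg (M t)) ∧
    ∀ t s, 0 ≤ t → t ≤ s → ∃ N, IsCondExp t (M s) N ∧ IsNonneg (M t - N)

end Adapted

/-! ### Flows and their generators -/

section Flow

variable {D H E K : Type*}
  [NormedAddCommGroup H] [InnerProductSpace ℂ H] [CompleteSpace H]
  [NormedAddCommGroup K] [InnerProductSpace ℂ K]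
  [AddCommGroup D] [Module ℂ D] [TopologicalSpace D] [IsTopologicalAddGroup D]
  [ContinuousSMul ℂ D]
  [AddCommGroup E] [Module ℂ E] [TopologicalSpace E] [IsTopologicalAddGroup E]
  [ContinuousSMul ℂ E]
  {SD : HilbertianScale D H} {SE : HilbertianScale E K}
  {𝒜 : OpStarAlgebra SD} {𝔞 : ItoAlgebra SE}

/-- Completely positive flows over `𝓑`. The map `φ t` is the normal (w*-continuous) extension of
`φ_t : 𝓑 → 𝔅` to the w*-closure `𝒜ᶜ` of `𝓑`, which is uniquely determined by its restriction
to `𝓑`. -/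
structure IsCPFlow (𝓑 : ObsAlgebra 𝒜) (φ : ℝ → commutant 𝒜 →ₗ[ℂ] bigB 𝒜 𝔞) : Prop where
  wstar_continuous : ∀ t, 0 ≤ t →
    @Continuous _ _ (TopologicalSpace.induced Subtype.val (wstar D))
      (TopologicalSpace.induced Subtype.val (wstar (BigD D SE))) (φ t)
  causal : ∀ t, 0 ≤ t → ∀ B : 𝓑.alg, IsAdapted t (φ t (𝓑.incl B)).1
  completely_positive : ∀ t, 0 < t → ∀ (n : ℕ) (B : Fin n → Fin n → 𝓑.alg),
    (∀ η : Fin n → D, 0 ≤ ∑ k, ∑ l, (𝓑.incl (B k l)).1.val (η k) (η l)) →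
      ∀ ψ : Fin n → BigD D SE, 0 ≤ ∑ k, ∑ l, (φ t (𝓑.incl (B k l))).1.val (ψ k) (ψ l)
  /-- The cocycle condition `φ_r ∘ φ_s^r = φ_{r+s}`, in terms of the coherent matrix elements. -/
  cocycle : ∀ (r s : ℝ) (hr : 0 < r), 0 < s → ∀ (B : 𝓑.alg) (η η' : D) (f h : TestFun SE),
    (φ (r + s) (𝓑.incl B)).1.val (prodVec f η) (prodVec h η') =
      (φ r ⟨_, cohElement_mem (φ s (𝓑.incl B)) (f.shift r hr.le) (h.shift r hr.le)⟩).1.val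
        (prodVec (f.trunc r) η) (prodVec (h.trunc r) η')

/-- The operator `η ↦ (η, η ⊗ e)` from `D` to `D ⊕ D_•`, where `D_• = D ⊗ E`. -/
def withNoise (e : E) : D →L[ℂ] D × CProj D E := (ContinuousLinearMap.id ℂ D).prod (tensL e)

/-- For a matrix `b = (b^μ_ν)`, given as a form on `D ⊕ D_•`, the form
`b(ē, e') = b^-_+ + ē b^•_+ + b^-_• e' + ē b^•_• e'` on `D`. -/
def noiseForm (b : Form (D × CProj D E)) (e e' : E) : Form D :=
  pullForm (withNoise e) (withNoise e') b

/-- The family `φ` is a quantum stochastically differentiable solution of the quantum stochastic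
equation `dφ_t(B) = φ_t(λ^μ_ν(B)) dΛ^ν_μ`, `φ_0(B) = B ⊗ I`, with the w*-continuous generator
`λ : 𝓑 → 𝓑(D ⊕ D_•)`: for all coherent matrix elements,
`d/dt ⟨ψ_f|φ_t(B) ψ'_h⟩ = ⟨ψ_f|φ_t(λ(f̄(t), B, h(t))) ψ'_h⟩`
at all times `t ≥ 0` at which the test functions `f` and `h` are continuous. -/
structure SolvesQSE (𝓑 : ObsAlgebra 𝒜) (φ : ℝ → commutant 𝒜 →ₗ[ℂ] bigB 𝒜 𝔞)
    (lam : 𝓑.alg →ₗ[ℂ] Form (D × CProj D E)) : Prop where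
  initial : ∀ B : 𝓑.alg, IsAmpliation (𝓑.incl B).1 (φ 0 (𝓑.incl B)).1
  weakly_continuous : ∀ (B : 𝓑.alg) (ψ ψ' : BigD D SE),
    ContinuousOn (fun t => (φ t (𝓑.incl B)).1.val ψ ψ') (Ici 0)
  gen_wstar_continuous :
    @Continuous _ _ (TopologicalSpace.induced (fun B => (𝓑.incl B).1) (wstar D))
      (wstar (D × CProj D E)) lam
  gen_mem : ∀ (B : 𝓑.alg) (e e' : E), noiseForm (lam B) e e' ∈ commutant 𝒜
  deriv_eq : ∀ (B : 𝓑.alg) (η η' : D) (f h : TestFun SE) (t : ℝ), 0 ≤ t →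
    ContinuousWithinAt f.toFun (Ici 0) t → ContinuousWithinAt h.toFun (Ici 0) t →
    HasDerivWithinAt (fun s => (φ s (𝓑.incl B)).1.val (prodVec f η) (prodVec h η'))
      ((φ t ⟨_, gen_mem B (f.toFun t) (h.toFun t)⟩).1.val (prodVec f η) (prodVec h η'))
      (Ici 0) t

/-- The family `R_t = φ_t(I)`. -/
def flowDensity (𝓑 : ObsAlgebra 𝒜) (φ : ℝ → commutant 𝒜 →ₗ[ℂ] bigB 𝒜 𝔞) (t : ℝ) :
    Form (BigD D SE) := (φ t (𝓑.incl 1)).1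

/-- The flow is subfiltering: `R_t` is a submartingale with `R_0 = I`. -/
def IsSubfiltering (𝓑 : ObsAlgebra 𝒜) (φ : ℝ → commutant 𝒜 →ₗ[ℂ] bigB 𝒜 𝔞) : Prop :=
  IsSubmartingale (flowDensity 𝓑 φ) ∧ IsAmpliation (𝓑.incl 1).1 (flowDensity 𝓑 φ 0)

/-- The flow is contractive: `I ≥ R_t ≥ R_s` for `0 ≤ t ≤ s`. -/
def IsContractive (𝓑 : ObsAlgebra 𝒜) (φ : ℝ → commutant 𝒜 →ₗ[ℂ] bigB 𝒜 𝔞) : Prop :=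
  ∃ I : Form (BigD D SE), IsAmpliation (𝓑.incl 1).1 I ∧
    ∀ t s, 0 ≤ t → t ≤ s →
      IsNonneg (I - flowDensity 𝓑 φ t) ∧ IsNonneg (flowDensity 𝓑 φ t - flowDensity 𝓑 φ s)

/-- The germ matrix `γ(B) = λ(B) + (0 ⊕ B ⊗ δ^•_•)` as a form on `D ⊕ D_•`. -/
def germ (SE : HilbertianScale E K) {𝓑 : ObsAlgebra 𝒜}
    (lam : 𝓑.alg →ₗ[ℂ] Form (D × CProj D E)) (B : 𝓑.alg) : Form (D × CProj D E) :=
  lam B + pullForm (ContinuousLinearMap.snd ℂ D (CProj D E))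
    (ContinuousLinearMap.snd ℂ D (CProj D E)) (ampForm SD SE B)

/-- The degenerate representation `ι(B) = B ⊕ 0`, as a map from `D ⊕ D_•` to the Hilbert space
sum of `H` and `H ⊗ K`. -/
def degRep (SD : HilbertianScale D H) (_SE : HilbertianScale E K) (B : H →L[ℂ] H)
    (ζ : D × CProj D E) : H × Completion (H ⊗[ℂ] K) :=
  (B (SD.emb ζ.1), 0)

end Flow

end

end QCP

open QCP

namespace QCP

noncomputable section

/-! ### Step functions and their truncations -/

section Pulse

variable {E K : Type*} [AddCommGroup E] [Module ℂ E] [TopologicalSpace E]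
  [NormedAddCommGroup K] [InnerProductSpace ℂ K] {S : HilbertianScale E K}

/-! The germ matrix is the right derivative at `t = 0` of the flow, tested on vectors `η ⊗ (e
1_{[0,t)})^⊗` that shrink to the vacuum together with `t`. The quantum stochastic equation
differentiates matrix elements between fixed coherent vectors, so one starts from `e 1_{[0,1)}`;
adaptedness shows that cutting at `t` only multiplies the matrix element by `exp((t-1)⟨e|e'⟩)`. The
product rule then gives `λ(ē, B, e') + ⟨e|e'⟩ B`, which is `γ(B)` between `(η, η ⊗ e)` and `(η', η'
⊗ e')` (`hasDerivWithinAt_trunc_pulse`). Finite sums of such vectors are dense in `D ⊕ D_•`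
(`denseRange_noiseSum`), and the formula extends to them by sesquilinearity.

All claims then follow from first-order expansion at `0`. The complete positivity sum is nonnegative
for `t > 0` and starts at `‖∑ B ζ_B‖²`, where only the `D` components enter (`initial_pulseSum`). If
this vanishes, the derivative is nonnegative. Hermiticity of `φ_t` passes to its derivative.
Subfiltering gives the sign of `λ^-_+(I)` on the vacuum. Contractivity gives that of `λ(I)`, because
on the moving vectors `R_0` has derivative `⟨e|e'⟩ I`, which cancels the difference between `γ(I)`
and `λ(I)`. -/

theorem TestFun.ext_toFun {f g : TestFun S} (h : f.toFun = g.toFun) : f = g := by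
  cases f
  cases g
  cases h
  rfl

/-- The step function `e 1_{[0,1)}`. -/
def pulse (S : HilbertianScale E K) (e : E) : TestFun S where
  toFun := (Ico (0 : ℝ) 1).indicator fun _ => e
  memLp ξ := by
    have h : MemLp ((Ico (0 : ℝ) 1).indicator fun _ : ℝ => S.toLvl ξ e) 2
        (volume.restrict (Ici (0 : ℝ))) :=
      (memLp_indicator_const 2 measurableSet_Ico _ (Or.inr measure_Ico_lt_top.ne)).restrict _
    refine h.ae_eq (Eventually.of_forall fun r => ?_)
    by_cases hr : r ∈ Ico (0 : ℝ) 1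
    · simp only [indicator_of_mem hr]
    · simp only [indicator_of_notMem hr, map_zero]

theorem pulse_toFun_zero (e : E) : (pulse S e).toFun 0 = e :=
  indicator_of_mem (s := Ico (0 : ℝ) 1) (by simp) fun _ => e

theorem continuousWithinAt_pulse (e : E) :
    ContinuousWithinAt (pulse S e).toFun (Ici 0) 0 := by
  refine (continuousWithinAt_const (b := e)).congr_of_eventuallyEq ?_ (pulse_toFun_zero e)
  filter_upwards [Ico_mem_nhdsGE (zero_lt_one' ℝ)] with r hr
  exact indicator_of_mem hr fun _ => e

theorem innerFrom_pulse (e e' : E) {t : ℝ} (h0 : 0 ≤ t) (h1 : t ≤ 1) :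
    (pulse S e).innerFrom t (pulse S e') = (1 - t : ℝ) * ⟪S.emb e, S.emb e'⟫_ℂ := by
  have h : (fun r => ⟪S.emb ((pulse S e).toFun r), S.emb ((pulse S e').toFun r)⟫_ℂ) =
      (Ico (0 : ℝ) 1).indicator fun _ => ⟪S.emb e, S.emb e'⟫_ℂ := by
    funext r
    by_cases hr : r ∈ Ico (0 : ℝ) 1
    · simp only [pulse, indicator_of_mem hr]
    · simp only [pulse, indicator_of_notMem hr, map_zero, inner_zero_left]
  have hI : Ici t ∩ Ico 0 1 = Ico t 1 := by
    ext r
    simp only [mem_inter_iff, mem_Ici, mem_Ico]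
    exact ⟨fun h => ⟨h.1, h.2.2⟩, fun h => ⟨h.1, h0.trans h.1, h.2⟩⟩
  rw [TestFun.innerFrom, h, setIntegral_indicator measurableSet_Ico, hI, setIntegral_const]
  simp [Measure.real, h1]

theorem innerFrom_trunc_pulse (e e' : E) {t : ℝ} (h0 : 0 ≤ t) (h1 : t ≤ 1) :
    ((pulse S e).trunc t).innerFrom 0 ((pulse S e').trunc t) =
      (t : ℂ) * ⟪S.emb e, S.emb e'⟫_ℂ := by
  have hI : Iio t ∩ Ico 0 1 = Ico 0 t := by
    ext r
    simp only [mem_inter_iff, mem_Iio, mem_Ico]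
    exact ⟨fun h => ⟨h.2.1, h.1⟩, fun h => ⟨h.2, h.1, h.2.trans_le h1⟩⟩
  have h : (fun r => ⟪S.emb (((pulse S e).trunc t).toFun r),
      S.emb (((pulse S e').trunc t).toFun r)⟫_ℂ) =
      (Ico 0 t).indicator fun _ => ⟪S.emb e, S.emb e'⟫_ℂ := by
    funext r
    simp only [TestFun.trunc, pulse, indicator_indicator, hI]
    by_cases hr : r ∈ Ico 0 t
    · simp only [indicator_of_mem hr]
    · simp only [indicator_of_notMem hr, map_zero, inner_zero_left]
  rw [TestFun.innerFrom, h, setIntegral_indicator measurableSet_Ico,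
    inter_eq_self_of_subset_right Ico_subset_Ici_self, setIntegral_const]
  simp [Measure.real, h0]

/-- For `e = 0` the moving test vectors all reduce to the vacuum. -/
theorem pulse_zero_trunc (t : ℝ) : (pulse S 0).trunc t = pulse S 0 := by
  apply TestFun.ext_toFun
  simp [TestFun.trunc, pulse]

end Pulse

/-! ### Evaluation of forms and the w*-topology -/

section Forms

variable {V : Type*} [AddCommGroup V] [Module ℂ V] [TopologicalSpace V]

theorem continuous_form_apply (Z : Form V) {X : Type*} [TopologicalSpace X] {f g : X → V}
    (hf : Continuous f) (hg : Continuous g) : Continuous fun x => Z.val (f x) (g x) :=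
  Z.2.comp (hf.prodMk hg)

/-- Matrix elements between single vectors are w*-continuous. -/
theorem continuous_wstar_apply (x y : V) :
    @Continuous _ _ (wstar V) _ fun Z : Form V => Z.val x y := by
  classical
  -- A single pair is a series of the predual with one nonzero term, so the summability condition is
  -- trivial.
  let X : ℕ → V := fun n => if n = 0 then x else 0
  let Y : ℕ → V := fun n => if n = 0 then y else 0
  have hs : ∀ p q : Seminorm ℂ V, Continuous p → Continuous q →
      Summable fun n => p (X n) * q (Y n) := by
    intro p q _ _
    refine summable_of_ne_finset_zero (s := {0}) fun n hn => ?_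
    have : n ≠ 0 := by simpa using hn
    simp [X, this]
  have he : (fun Z : Form V => Z.val x y) = fun Z : Form V => ∑' n, Z.val (X n) (Y n) := by
    funext Z
    rw [tsum_eq_single 0 fun n hn => by simp [X, hn]]
    simp [X, Y]
  rw [he]
  refine continuous_iff_le_induced.2 ?_
  exact (iInf_le _ X).trans ((iInf_le _ Y).trans (iInf_le _ hs))

end Forms

section Tensor

variable {V W : Type*} [AddCommGroup V] [Module ℂ V] [TopologicalSpace V]
  [AddCommGroup W] [Module ℂ W] [TopologicalSpace W]

theorem tens_zero (v : V) : tens v (0 : W) = 0 := by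
  exact (congrArg _ (map_zero (ptmul v))).trans Completion.coe_zero

end Tensor

/-! ### Test vectors and their density in `D ⊕ D_•` -/

section System

variable {D H E K : Type*}
  [NormedAddCommGroup H] [InnerProductSpace ℂ H] [NormedAddCommGroup K] [InnerProductSpace ℂ K]
  [AddCommGroup D] [Module ℂ D] [TopologicalSpace D]
  [AddCommGroup E] [Module ℂ E] [TopologicalSpace E]

theorem ampForm_tens (SD : HilbertianScale D H) (SE : HilbertianScale E K) (B : H →L[ℂ] H)
    (η η' : D) (e e' : E) : (ampForm SD SE B).val (tens η e) (tens η' e') =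
      ⟪SD.emb η, B (SD.emb η')⟫_ℂ * ⟪SE.emb e, SE.emb e'⟫_ℂ := by
  simp only [ampForm, pullForm, tens, LinearMap.mk₂'ₛₗ_apply,
    ContinuousLinearMap.completion_apply_coe]
  exact (Completion.inner_coe _ _).trans (TensorProduct.inner_tmul ..)

/-- The vectors `∑ (a(e), a(e) ⊗ e)` of `D ⊕ D_•`. -/
def noiseSum (D E : Type*) [AddCommGroup D] [Module ℂ D] [TopologicalSpace D]
    [AddCommGroup E] [Module ℂ E] [TopologicalSpace E] : (E →₀ D) →ₗ[ℂ] D × CProj D E :=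
  Finsupp.lsum ℂ fun e => (withNoise (D := D) e).toLinearMap

/-- The vectors `∑ a(e) ⊗ (e 1_{[0,t)})^⊗` of `𝔇`, for `0 ≤ t ≤ 1`. -/
def pulseSum (D : Type*) [AddCommGroup D] [Module ℂ D] [TopologicalSpace D]
    (SE : HilbertianScale E K) (t : ℝ) : (E →₀ D) →ₗ[ℂ] BigD D SE :=
  Finsupp.lsum ℂ fun e => (prodVec (D := D) ((pulse SE e).trunc t)).toLinearMap

theorem noiseSum_single (e : E) (η : D) :
    noiseSum D E (Finsupp.single e η) = (η, tens η e) := by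
  simp [noiseSum]
  rfl

theorem pulseSum_single (SE : HilbertianScale E K) (t : ℝ) (e : E) (η : D) :
    pulseSum D SE t (Finsupp.single e η) = prodVec ((pulse SE e).trunc t) η := by
  simp [pulseSum]

/-- Taking `e = 0` produces `(η, 0)`, and subtracting it from `(η, η ⊗ e)` isolates `(0, η ⊗ e)`.
The `D` component is reached exactly and not merely in the limit, which later allows a linear
constraint on it to be kept during approximation. -/
theorem mem_range_noiseSum (η : D) (z : ProjTensor D E) :
    ((η, (z : Completion (ProjTensor D E))) : D × CProj D E) ∈
      LinearMap.range (noiseSum D E) := by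
  have h1 : ∀ η : D, ((η, 0) : D × CProj D E) ∈ LinearMap.range (noiseSum D E) := fun η =>
    ⟨Finsupp.single 0 η, by rw [noiseSum_single, tens_zero]⟩
  have h2 : ∀ z : D ⊗[ℂ] E, ((0, (show ProjTensor D E from z : Completion (ProjTensor D E))) :
      D × CProj D E) ∈ LinearMap.range (noiseSum D E) := by
    intro z
    induction z with
    | zero => exact Submodule.zero_mem _
    | tmul η e =>
      have h := Submodule.sub_mem _ (LinearMap.mem_range_self (noiseSum D E)
        (Finsupp.single e η)) (h1 η)
      rw [noiseSum_single, Prod.mk_sub_mk, sub_self, sub_zero] at h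
      exact h
    | add x y hx hy =>
      have h := Submodule.add_mem _ hx hy
      rw [Prod.mk_add_mk, add_zero] at h
      refine Eq.subst (motive := fun w => w ∈ LinearMap.range (noiseSum D E)) ?_ h
      exact congrArg (Prod.mk 0) (Completion.coe_add (α := ProjTensor D E) x y).symm
  have h := Submodule.add_mem _ (h1 η) (h2 z)
  rw [Prod.mk_add_mk, add_zero, zero_add] at h
  exact h

theorem denseRange_noiseSum : DenseRange (noiseSum D E) := by
  have h : DenseRange (Prod.map (id : D → D) ((↑) : ProjTensor D E → CProj D E)) :=
    denseRange_id.prodMap Completion.denseRange_coe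
  refine h.mono ?_
  rintro _ ⟨⟨η, z⟩, rfl⟩
  exact mem_range_noiseSum η z

/-- Right derivatives along `pulseSum` can be computed on single product vectors. -/
theorem hasDerivWithinAt_pulseSum_of_single {SE : HilbertianScale E K}
    (Z : ℝ → Form (BigD D SE))
    (G : Form (D × CProj D E)) (h : ∀ (e e' : E) (η η' : D),
      HasDerivWithinAt (fun t => (Z t).val (prodVec ((pulse SE e).trunc t) η)
        (prodVec ((pulse SE e').trunc t) η')) (G.val (η, tens η e) (η', tens η' e')) (Ici 0) 0)
    (a b : E →₀ D) :
    HasDerivWithinAt (fun t => (Z t).val (pulseSum D SE t a) (pulseSum D SE t b))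
      (G.val (noiseSum D E a) (noiseSum D E b)) (Ici 0) 0 := by
  induction a using Finsupp.induction_linear with
  | zero =>
    simp only [map_zero, LinearMap.zero_apply]
    exact hasDerivWithinAt_const _ _ _
  | add a₁ a₂ h₁ h₂ =>
    simp only [map_add, LinearMap.add_apply]
    exact h₁.add h₂
  | single e η =>
    induction b using Finsupp.induction_linear with
    | zero =>
      simp only [map_zero]
      exact hasDerivWithinAt_const _ _ _
    | add b₁ b₂ h₁ h₂ =>
      simp only [map_add]
      exact h₁.add h₂
    | single e' η' =>
      simp only [pulseSum_single, noiseSum_single]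
      exact h e e' η η'

end System

/-! ### The germ matrix as a derivative at time zero -/

section Flow

variable {D H E K : Type*}
  [NormedAddCommGroup H] [InnerProductSpace ℂ H] [CompleteSpace H]
  [NormedAddCommGroup K] [InnerProductSpace ℂ K]
  [AddCommGroup D] [Module ℂ D] [TopologicalSpace D] [IsTopologicalAddGroup D]
  [ContinuousSMul ℂ D]
  [AddCommGroup E] [Module ℂ E] [TopologicalSpace E] [IsTopologicalAddGroup E]
  [ContinuousSMul ℂ E]
  {SD : HilbertianScale D H} {SE : HilbertianScale E K}
  {𝒜 : OpStarAlgebra SD} {𝔞 : ItoAlgebra SE} {𝓑 : ObsAlgebra 𝒜}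
  {φ : ℝ → commutant 𝒜 →ₗ[ℂ] bigB 𝒜 𝔞} {lam : 𝓑.alg →ₗ[ℂ] Form (D × CProj D E)}

/-- The initial condition `φ_0(Y) = Y ⊗ I` extends from `𝓑` to its w*-closure. -/
theorem initial_commutant (hφ : IsCPFlow 𝓑 φ) (hlam : SolvesQSE 𝓑 φ lam) (Y : commutant 𝒜) :
    IsAmpliation Y.1 (φ 0 Y).1 := by
  intro η η' f h
  let tB : TopologicalSpace (bigB 𝒜 𝔞) :=
    TopologicalSpace.induced Subtype.val (wstar (BigD D SE))
  let tF : TopologicalSpace (Form D) := wstar D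
  let tC : TopologicalSpace (commutant 𝒜) := TopologicalSpace.induced Subtype.val (wstar D)
  have hc : Continuous (φ 0) := hφ.wstar_continuous 0 le_rfl
  have hv : @Continuous _ _ tB (wstar (BigD D SE)) Subtype.val := continuous_induced_dom
  have h1 : Continuous fun Y : commutant 𝒜 => (φ 0 Y).1.val (prodVec f η) (prodVec h η') :=
    (@Continuous.comp _ _ _ tB (wstar (BigD D SE)) _ _ _
      (continuous_wstar_apply _ _) hv).comp hc
  have h2 : Continuous fun Y : commutant 𝒜 => Y.1.val η η' * Complex.exp (f.innerFrom 0 h) :=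
    ((continuous_wstar_apply η η').comp continuous_induced_dom).mul continuous_const
  -- The commutant carries the topology induced from forms on `D`, so the closure can be computed
  -- there, where `𝓑` is dense.
  have hd : Y ∈ closure (range 𝓑.incl) := by
    rw [closure_induced, ← range_comp]
    exact 𝓑.dense Y.1 Y.2
  refine closure_minimal (t := {Y : commutant 𝒜 | (φ 0 Y).1.val (prodVec f η) (prodVec h η') =
    Y.1.val η η' * Complex.exp (f.innerFrom 0 h)}) ?_ (isClosed_eq h1 h2) hd
  rintro _ ⟨B, rfl⟩
  exact hlam.initial B η η' f h

theorem germ_withNoise (B : 𝓑.alg) (e e' : E) (η η' : D) :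
    (germ SE lam B).val (η, tens η e) (η', tens η' e') = (noiseForm (lam B) e e').val η η' +
      (𝓑.incl B).1.val η η' * ⟪SE.emb e, SE.emb e'⟫_ℂ :=
  congrArg (_ + ·) (ampForm_tens SD SE B η η' e e')

/-- By adaptedness the part of the pulses on `[t, 1)` contributes only the scalar
`exp((1-t)⟨e|e'⟩)`. This trades a test vector depending on `t` for a fixed one, to which the
stochastic equation applies. -/
theorem apply_trunc_pulse (hφ : IsCPFlow 𝓑 φ) (B : 𝓑.alg) (e e' : E) (η η' : D) {t : ℝ}
    (h0 : 0 ≤ t) (h1 : t ≤ 1) :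
    (φ t (𝓑.incl B)).1.val (prodVec ((pulse SE e).trunc t) η)
        (prodVec ((pulse SE e').trunc t) η') =
      (φ t (𝓑.incl B)).1.val (prodVec (pulse SE e) η) (prodVec (pulse SE e') η') *
        Complex.exp (((t - 1 : ℝ) : ℂ) * ⟪SE.emb e, SE.emb e'⟫_ℂ) := by
  rw [hφ.causal t h0 B η η' (pulse SE e) (pulse SE e'), innerFrom_pulse e e' h0 h1, mul_assoc,
    ← Complex.exp_add, ← add_mul]
  simp

theorem initial_trunc_pulse (hφ : IsCPFlow 𝓑 φ) (hlam : SolvesQSE 𝓑 φ lam) (B : 𝓑.alg)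
    (e e' : E) (η η' : D) :
    (φ 0 (𝓑.incl B)).1.val (prodVec ((pulse SE e).trunc 0) η)
      (prodVec ((pulse SE e').trunc 0) η') = (𝓑.incl B).1.val η η' := by
  rw [apply_trunc_pulse hφ B e e' η η' le_rfl zero_le_one, hlam.initial B η η',
    innerFrom_pulse e e' le_rfl zero_le_one, mul_assoc, ← Complex.exp_add, ← add_mul]
  simp

/-- The germ matrix is the right derivative of the flow at the vacuum. -/
theorem hasDerivWithinAt_trunc_pulse (hφ : IsCPFlow 𝓑 φ) (hlam : SolvesQSE 𝓑 φ lam)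
    (B : 𝓑.alg) (e e' : E) (η η' : D) :
    HasDerivWithinAt (fun t => (φ t (𝓑.incl B)).1.val (prodVec ((pulse SE e).trunc t) η)
        (prodVec ((pulse SE e').trunc t) η'))
      ((germ SE lam B).val (η, tens η e) (η', tens η' e')) (Ici 0) 0 := by
  set c : ℂ := ⟪SE.emb e, SE.emb e'⟫_ℂ with hc
  have hd := hlam.deriv_eq B η η' (pulse SE e) (pulse SE e') 0 le_rfl
    (continuousWithinAt_pulse e) (continuousWithinAt_pulse e')
  have hexp : HasDerivWithinAt (fun t : ℝ => Complex.exp (((t - 1 : ℝ) : ℂ) * c))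
      (Complex.exp (((0 - 1 : ℝ) : ℂ) * c) * (1 * c)) (Ici 0) 0 := by
    have h1 : HasDerivAt (fun t : ℝ => t - 1) 1 0 := (hasDerivAt_id 0).sub_const 1
    have h2 := (h1.ofReal_comp.mul_const c).cexp
    rw [Complex.ofReal_one] at h2
    exact h2.hasDerivWithinAt
  have h := hd.mul hexp
  -- The derivative is `φ_0` of `λ(ē, B, e')`, which lies in the commutant but need not come from
  -- `𝓑`; hence the extended initial condition.
  rw [initial_commutant hφ hlam _ η η', hlam.initial B η η',
    innerFrom_pulse e e' le_rfl zero_le_one] at h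
  -- In the product rule the exponentials cancel at `t = 0`, and differentiating the scalar factor
  -- yields exactly the term `B ⊗ δ^•_•` of the germ.
  have hval : (germ SE lam B).val (η, tens η e) (η', tens η' e') =
      (noiseForm (lam B) e e').val η η' * Complex.exp (((1 - 0 : ℝ) : ℂ) * c) *
          Complex.exp (((0 - 1 : ℝ) : ℂ) * c) +
        (𝓑.incl B).1.val η η' * Complex.exp (((1 - 0 : ℝ) : ℂ) * c) *
          (Complex.exp (((0 - 1 : ℝ) : ℂ) * c) * (1 * c)) := by
    have h1 : Complex.exp (((1 - 0 : ℝ) : ℂ) * c) * Complex.exp (((0 - 1 : ℝ) : ℂ) * c) = 1 := by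
      rw [← Complex.exp_add, ← add_mul]
      simp
    rw [germ_withNoise]
    linear_combination (-(noiseForm (lam B) e e').val η η' - (𝓑.incl B).1.val η η' * c) * h1
  rw [hval]
  simp only [pulse_toFun_zero] at h
  refine h.congr_of_eventuallyEq ?_ (apply_trunc_pulse hφ B e e' η η' le_rfl zero_le_one)
  filter_upwards [Icc_mem_nhdsGE (zero_lt_one' ℝ)] with t ht
  exact apply_trunc_pulse hφ B e e' η η' ht.1 ht.2

/-- At time `0` every pulse is cut down to the vacuum, so the noise components disappear. This is
where the degenerate representation `ι` comes from. -/
theorem initial_pulseSum (hφ : IsCPFlow 𝓑 φ) (hlam : SolvesQSE 𝓑 φ lam) (B : 𝓑.alg)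
    (a b : E →₀ D) :
    (φ 0 (𝓑.incl B)).1.val (pulseSum D SE 0 a) (pulseSum D SE 0 b) =
      ⟪SD.emb (noiseSum D E a).1, B.1 (SD.emb (noiseSum D E b).1)⟫_ℂ := by
  induction a using Finsupp.induction_linear with
  | zero => simp
  | add a₁ a₂ h₁ h₂ =>
    simp only [map_add, LinearMap.add_apply, Prod.fst_add, inner_add_left, h₁, h₂]
  | single e η =>
    induction b using Finsupp.induction_linear with
    | zero => simp
    | add b₁ b₂ h₁ h₂ => simp only [map_add, Prod.fst_add, inner_add_right, h₁, h₂]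
    | single e' η' =>
      simp only [pulseSum_single, noiseSum_single]
      exact initial_trunc_pulse hφ hlam B e e' η η'

theorem hasDerivWithinAt_pulseSum (hφ : IsCPFlow 𝓑 φ) (hlam : SolvesQSE 𝓑 φ lam)
    (B : 𝓑.alg) (a b : E →₀ D) :
    HasDerivWithinAt
      (fun t => (φ t (𝓑.incl B)).1.val (pulseSum D SE t a) (pulseSum D SE t b))
      ((germ SE lam B).val (noiseSum D E a) (noiseSum D E b)) (Ici 0) 0 :=
  hasDerivWithinAt_pulseSum_of_single (fun t => (φ t (𝓑.incl B)).1) (germ SE lam B)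
    (hasDerivWithinAt_trunc_pulse hφ hlam B) a b

/-! ### Positivity and its infinitesimal form -/

theorem nonneg_of_hasDerivWithinAt {F : ℝ → ℂ} {F' : ℂ} (h : HasDerivWithinAt F F' (Ici 0) 0)
    (h0 : F 0 = 0) (hF : ∀ t, 0 < t → 0 ≤ F t) : 0 ≤ F' := by
  -- Only slopes at `t > 0` enter, and they lie in the closed cone of nonnegative reals in `ℂ`.
  rw [hasDerivWithinAt_iff_tendsto_slope, Ici_sdiff_left] at h
  refine ge_of_tendsto h ?_
  filter_upwards [self_mem_nhdsWithin] with t ht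
  rw [slope_def_module, h0, sub_zero, sub_zero]
  exact smul_nonneg (inv_nonneg.2 (le_of_lt ht)) (hF t ht)

/-- This Gram identity serves twice: it makes `[B_k^* B_l]` a positive matrix, so that complete
positivity applies, and it identifies the value at `t = 0` of the positive sum. -/
theorem sum_inner_star_mul {ι : Type*} (s : Finset ι) (B : ι → 𝓑.alg) (x : ι → H) :
    ∑ k ∈ s, ∑ l ∈ s, ⟪x k, (star (B k) * B l).1 (x l)⟫_ℂ =
      ⟪∑ k ∈ s, (B k).1 (x k), ∑ k ∈ s, (B k).1 (x k)⟫_ℂ := by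
  simp only [sum_inner, inner_sum]
  rw [Finset.sum_comm]
  refine Finset.sum_congr rfl fun k _ => Finset.sum_congr rfl fun l _ => ?_
  exact ContinuousLinearMap.adjoint_inner_right (B l).1 (x l) ((B k).1 (x k))

/-- Complete positivity in the form `∑ ⟨ψ_k|φ_t(B_k^* B_l) ψ_l⟩ ≥ 0`. -/
theorem sum_star_mul_nonneg (hφ : IsCPFlow 𝓑 φ) {t : ℝ} (ht : 0 < t) (s : Finset 𝓑.alg)
    (ψ : 𝓑.alg → BigD D SE) :
    0 ≤ ∑ B ∈ s, ∑ C ∈ s, (φ t (𝓑.incl (star B * C))).1.val (ψ B) (ψ C) := by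
  let b : Fin s.card → 𝓑.alg := fun k => s.equivFin.symm k
  have hsum : ∀ F : 𝓑.alg → ℂ, ∑ k, F (b k) = ∑ B ∈ s, F B := fun F =>
    (s.equivFin.symm.sum_comp fun B => F B).trans (Finset.sum_coe_sort s F)
  have h := hφ.completely_positive t ht s.card (fun k l => star (b k) * b l) (fun η => by
    have h := sum_inner_star_mul Finset.univ b fun k => SD.emb (η k)
    rw [inner_self_eq_norm_sq_to_K, ← RCLike.ofReal_pow] at h
    exact (Complex.zero_le_real.2 (sq_nonneg _)).trans_eq h.symm) (fun k => ψ (b k))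
  refine h.trans_eq ?_
  rw [← hsum]
  exact Finset.sum_congr rfl fun k _ =>
    hsum fun C => (φ t (𝓑.incl (star (b k) * C))).1.val (ψ (b k)) (ψ C)

theorem apply_star_mul_self_nonneg (hφ : IsCPFlow 𝓑 φ) {t : ℝ} (ht : 0 < t) (B : 𝓑.alg)
    (ψ : BigD D SE) : 0 ≤ (φ t (𝓑.incl (star B * B))).1.val ψ ψ := by
  simpa using sum_star_mul_nonneg hφ ht {B} fun _ => ψ

/-- Complete positivity for the Gram matrix of the row `(1, B)` gives a real sum whose diagonal
terms are real, so the two off-diagonal terms add up to a real number. This relates the imaginary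
parts; replacing `ψ` by `iψ` relates the real parts. -/
theorem apply_star_eq_conj (hφ : IsCPFlow 𝓑 φ) {t : ℝ} (ht : 0 < t) (B : 𝓑.alg)
    (ψ ψ' : BigD D SE) :
    (φ t (𝓑.incl (star B))).1.val ψ ψ' = conj ((φ t (𝓑.incl B)).1.val ψ' ψ) := by
  have key : ∀ ψ ψ' : BigD D SE, ((φ t (𝓑.incl B)).1.val ψ' ψ +
      (φ t (𝓑.incl (star B))).1.val ψ ψ').im = 0 := by
    intro ψ ψ'
    have h1 := hφ.completely_positive t ht 2 (fun k l => star (![1, B] k) * ![1, B] l) (fun η => by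
      have h := sum_inner_star_mul Finset.univ ![1, B] fun k => SD.emb (η k)
      rw [inner_self_eq_norm_sq_to_K, ← RCLike.ofReal_pow] at h
      exact (Complex.zero_le_real.2 (sq_nonneg _)).trans_eq h.symm) ![ψ', ψ]
    have h2 := apply_star_mul_self_nonneg hφ ht 1 ψ'
    have h3 := apply_star_mul_self_nonneg hφ ht B ψ
    simp only [Fin.sum_univ_two, Matrix.cons_val_zero, Matrix.cons_val_one, star_one, one_mul,
      mul_one] at h1 h2 h3
    have i1 := (Complex.nonneg_iff.1 h1).2
    have i2 := (Complex.nonneg_iff.1 h2).2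
    have i3 := (Complex.nonneg_iff.1 h3).2
    simp only [Complex.add_im] at i1 ⊢
    linarith
  have h1 := key ψ ψ'
  have h2 := key (Complex.I • ψ) ψ'
  simp only [map_smul, LinearMap.map_smulₛₗ, LinearMap.smul_apply, Complex.conj_I, smul_eq_mul,
    Complex.add_im, Complex.mul_im, Complex.I_re, Complex.I_im, Complex.neg_re,
    Complex.neg_im] at h1 h2
  apply Complex.ext
  · rw [Complex.conj_re]
    linarith
  · rw [Complex.conj_im]
    linarith

/-- On the dense set of test vectors both sides are right derivatives of the same function of `t`.
-/
theorem germ_star_apply (hφ : IsCPFlow 𝓑 φ) (hlam : SolvesQSE 𝓑 φ lam) (B : 𝓑.alg)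
    (x y : D × CProj D E) :
    (germ SE lam (star B)).val x y = conj ((germ SE lam B).val y x) := by
  refine isClosed_property2 (p := fun x y =>
    (germ SE lam (star B)).val x y = conj ((germ SE lam B).val y x))
    (denseRange_noiseSum (D := D) (E := E))
    (isClosed_eq (germ SE lam (star B)).2 (Complex.continuous_conj.comp
      (continuous_form_apply _ continuous_snd continuous_fst))) (fun a b => ?_) x y
  -- Hermiticity of `φ_t` comes from positivity at `t > 0`, hence the open half-line; agreement at
  -- `0` is checked separately from the initial values.
  have h1 := (hasDerivWithinAt_pulseSum hφ hlam (star B) a b).mono Ioi_subset_Ici_self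
  have h2 := ((hasDerivWithinAt_pulseSum hφ hlam B b a).star).mono Ioi_subset_Ici_self
  refine (uniqueDiffWithinAt_Ioi (0 : ℝ)).eq_deriv _ (h1.congr ?_ ?_) h2
  · exact fun t ht => (apply_star_eq_conj hφ ht B _ _).symm
  · rw [initial_pulseSum hφ hlam, initial_pulseSum hφ hlam]
    refine (inner_conj_symm _ _).trans ?_
    exact (ContinuousLinearMap.adjoint_inner_right B.1 _ _).symm

/-- The constraint says that the complete positivity sum, nonnegative for `t > 0`, starts from zero;
its right derivative is the germ sum. -/
theorem germ_conditionally_positive (hφ : IsCPFlow 𝓑 φ) (hlam : SolvesQSE 𝓑 φ lam)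
    (s : Finset 𝓑.alg) (a : 𝓑.alg → E →₀ D)
    (ha : ∑ B ∈ s, B.1 (SD.emb (noiseSum D E (a B)).1) = 0) :
    0 ≤ ∑ B ∈ s, ∑ C ∈ s,
      (germ SE lam (star B * C)).val (noiseSum D E (a B)) (noiseSum D E (a C)) := by
  have h : HasDerivWithinAt (fun t => ∑ B ∈ s, ∑ C ∈ s, (φ t (𝓑.incl (star B * C))).1.val
      (pulseSum D SE t (a B)) (pulseSum D SE t (a C))) _ (Ici 0) 0 :=
    HasDerivWithinAt.fun_sum fun B _ => HasDerivWithinAt.fun_sum fun C _ =>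
      hasDerivWithinAt_pulseSum hφ hlam (star B * C) (a B) (a C)
  refine nonneg_of_hasDerivWithinAt h ?_ fun t ht => sum_star_mul_nonneg hφ ht s _
  simp only [initial_pulseSum hφ hlam]
  refine (sum_inner_star_mul s id fun B => SD.emb (noiseSum D E (a B)).1).trans ?_
  simp only [id]
  rw [ha, inner_zero_left]

/-- The constraint involves only the `D` components. Keeping these fixed and approximating the `D_•`
components by algebraic tensors therefore never violates it, and the inequality passes to the limit.
-/
theorem degRep_germ_nonneg (hφ : IsCPFlow 𝓑 φ) (hlam : SolvesQSE 𝓑 φ lam)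
    (s : Finset 𝓑.alg) (ζ : 𝓑.alg → D × CProj D E)
    (hζ : ∑ B ∈ s, degRep SD SE B (ζ B) = 0) :
    0 ≤ ∑ B ∈ s, ∑ C ∈ s, (germ SE lam (star B * C)).val (ζ B) (ζ C) := by
  have h0 : ∑ B ∈ s, B.1 (SD.emb (ζ B).1) = 0 := by
    have h := congrArg Prod.fst hζ
    rwa [Prod.fst_sum] at h
  have hd : DenseRange (Pi.map fun (_ : 𝓑.alg) => ((↑) : ProjTensor D E → CProj D E)) :=
    DenseRange.piMap fun _ => Completion.denseRange_coe
  have hc : Continuous fun z : 𝓑.alg → CProj D E => ∑ B ∈ s, ∑ C ∈ s,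
      (germ SE lam (star B * C)).val ((ζ B).1, z B) ((ζ C).1, z C) :=
    continuous_finsetSum _ fun B _ => continuous_finsetSum _ fun C _ =>
      continuous_form_apply _ (continuous_const.prodMk (continuous_apply B))
        (continuous_const.prodMk (continuous_apply C))
  refine hd.induction_on (p := fun z : 𝓑.alg → CProj D E => 0 ≤ ∑ B ∈ s, ∑ C ∈ s,
    (germ SE lam (star B * C)).val ((ζ B).1, z B) ((ζ C).1, z C)) (fun B => (ζ B).2)
    (isClosed_le continuous_const hc) fun z => ?_
  choose a ha using fun B => mem_range_noiseSum (ζ B).1 (z B)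
  have h := germ_conditionally_positive hφ hlam s a (by simpa only [ha] using h0)
  simp only [ha] at h
  exact h

/-! ### Subfiltering and contractive flows -/

theorem neg_lam_one_nonneg_of_isSubfiltering (hφ : IsCPFlow 𝓑 φ) (hlam : SolvesQSE 𝓑 φ lam)
    (h : IsSubfiltering 𝓑 φ) (η : D) : 0 ≤ (-lam 1).val (η, 0) (η, 0) := by
  have hg : (germ SE lam (1 : 𝓑.alg)).val (η, 0) (η, 0) = (lam 1).val (η, 0) (η, 0) := by
    have h := germ_withNoise (lam := lam) (SE := SE) (1 : 𝓑.alg) 0 0 η η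
    rw [map_zero SE.emb, inner_zero_left, mul_zero, add_zero, tens_zero] at h
    rw [h, noiseForm]
    simp only [pullForm, LinearMap.mk₂'ₛₗ_apply]
    change (lam 1).val (η, tens η 0) (η, tens η 0) = _
    rw [tens_zero]
  have hd := hasDerivWithinAt_trunc_pulse hφ hlam 1 (0 : E) 0 η η
  simp only [pulse_zero_trunc, tens_zero, hg] at hd
  have h2 := (hasDerivWithinAt_const (0 : ℝ) (Ici (0 : ℝ))
    ((φ 0 (𝓑.incl 1)).1.val (prodVec (pulse SE 0) η) (prodVec (pulse SE 0) η))).sub hd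
  rw [zero_sub] at h2
  refine nonneg_of_hasDerivWithinAt h2 (sub_self _) fun t ht => ?_
  -- On vacuum vectors truncation changes nothing and the exponential factor is `1`, so `ε_0(R_t)`
  -- agrees there with `R_t`, and `ε_0(R_t) ≤ R_0` bounds `R_t` by `R_0`.
  obtain ⟨N, hN, hpos⟩ := h.1.2 0 t le_rfl ht.le
  have h3 := hN η η (pulse SE 0) (pulse SE 0)
  have h4 : (pulse SE 0).innerFrom 0 (pulse SE 0) = 0 := by
    rw [innerFrom_pulse _ _ le_rfl zero_le_one, map_zero, inner_zero_left, mul_zero]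
  rw [pulse_zero_trunc, h4, Complex.exp_zero, mul_one] at h3
  have h5 := hpos (prodVec (pulse SE 0) η)
  change 0 ≤ (φ 0 (𝓑.incl 1)).1.val _ _ - N.val _ _ at h5
  rw [h3] at h5
  exact h5

/-- The decreasing property makes `R_0 - R_t` nonnegative, and this form vanishes at `t = 0`. On the
moving pulses its derivative is `-λ(I)`, not `-γ(I)`, since `R_0` itself contributes the derivative
of `exp(t⟨e|e'⟩)`. -/
theorem isNonneg_neg_lam_one_of_isContractive (hφ : IsCPFlow 𝓑 φ) (hlam : SolvesQSE 𝓑 φ lam)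
    (h : IsContractive 𝓑 φ) : IsNonneg (-lam 1) := by
  obtain ⟨_, _, hle⟩ := h
  have hd := hasDerivWithinAt_pulseSum_of_single 
    (fun t => flowDensity 𝓑 φ 0 - flowDensity 𝓑 φ t) (-lam 1)
    fun e e' η η' => by
      set c : ℂ := ⟪SE.emb e, SE.emb e'⟫_ℂ
      have hexp : HasDerivWithinAt
          (fun t : ℝ => (𝓑.incl 1).1.val η η' * Complex.exp ((t : ℂ) * c))
          ((𝓑.incl 1).1.val η η' * (Complex.exp (((0 : ℝ) : ℂ) * c) * (1 * c))) (Ici 0) 0 := by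
        have h2 := ((hasDerivAt_id (0 : ℝ)).ofReal_comp.mul_const c).cexp
        rw [Complex.ofReal_one] at h2
        exact (h2.const_mul _).hasDerivWithinAt
      have hEq : ∀ t : ℝ, 0 ≤ t → t ≤ 1 → (flowDensity 𝓑 φ 0).val (prodVec ((pulse SE e).trunc t) η)
          (prodVec ((pulse SE e').trunc t) η') =
            (𝓑.incl 1).1.val η η' * Complex.exp ((t : ℂ) * c) := fun t h0 h1 => by
        rw [flowDensity, hlam.initial, innerFrom_trunc_pulse e e' h0 h1]
      have hIt := hexp.congr_of_eventuallyEq (f₁ := fun t =>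
        (flowDensity 𝓑 φ 0).val (prodVec ((pulse SE e).trunc t) η) (prodVec ((pulse SE e').trunc t) η')) (by
          filter_upwards [Icc_mem_nhdsGE (zero_lt_one' ℝ)] with t ht
          exact hEq t ht.1 ht.2) (hEq 0 le_rfl zero_le_one)
      refine (hIt.sub (hasDerivWithinAt_trunc_pulse hφ hlam 1 e e' η η')).congr_deriv ?_
      rw [germ_withNoise, Complex.ofReal_zero, zero_mul, Complex.exp_zero]
      change _ = -(noiseForm (lam 1) e e').val η η'
      ring
  have hc : Continuous fun x : D × CProj D E => (-lam 1).val x x :=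
    continuous_form_apply _ continuous_id continuous_id
  refine fun x => denseRange_noiseSum.induction_on
    (p := fun x : D × CProj D E => 0 ≤ (-lam 1).val x x) x
    (isClosed_le continuous_const hc) fun a => ?_
  refine nonneg_of_hasDerivWithinAt (hd a a) (sub_self _) fun t ht => (hle 0 t le_rfl ht.le).2 _

end Flow

end

end QCP

theorem mainTheorem4 {H K D E : Type*}
    [NormedAddCommGroup H] [InnerProductSpace ℂ H] [CompleteSpace H]
    [NormedAddCommGroup K] [InnerProductSpace ℂ K] [CompleteSpace K]
    [AddCommGroup D] [Module ℂ D] [UniformSpace D] [IsUniformAddGroup D] [ContinuousSMul ℂ D]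
    [CompleteSpace D]
    [AddCommGroup E] [Module ℂ E] [UniformSpace E] [IsUniformAddGroup E] [ContinuousSMul ℂ E]
    [CompleteSpace E]
    (SD : HilbertianScale D H) (SE : HilbertianScale E K)
    (𝒜 : OpStarAlgebra SD) (𝔞 : ItoAlgebra SE) (𝓑 : ObsAlgebra 𝒜)
    (φ : ℝ → commutant 𝒜 →ₗ[ℂ] bigB 𝒜 𝔞) (lam : 𝓑.alg →ₗ[ℂ] Form (D × CProj D E))
    (hφ : IsCPFlow 𝓑 φ) (hlam : SolvesQSE 𝓑 φ lam) :
    (∀ (s : Finset 𝓑.alg) (ζ : 𝓑.alg → D × CProj D E),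
      ∑ B ∈ s, degRep SD SE B (ζ B) = 0 →
        0 ≤ ∑ B ∈ s, ∑ C ∈ s, (germ SE lam (star B * C)).val (ζ B) (ζ C)) ∧
    (∀ (B : 𝓑.alg) (η η' : D), (germ SE lam (star B)).val (η, 0) (η', 0) =
      conj ((germ SE lam B).val (η', 0) (η, 0))) ∧
    (∀ (B : 𝓑.alg) (ζ : CProj D E) (η : D), (germ SE lam (star B)).val (0, ζ) (η, 0) =
      conj ((germ SE lam B).val (η, 0) (0, ζ))) ∧
    (∀ (B : 𝓑.alg) (ζ ζ' : CProj D E), (germ SE lam (star B)).val (0, ζ) (0, ζ') =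
      conj ((germ SE lam B).val (0, ζ') (0, ζ))) ∧
    (IsSubfiltering 𝓑 φ → ∀ η : D, 0 ≤ (-lam 1).val (η, 0) (η, 0)) ∧
    (IsContractive 𝓑 φ → IsNonneg (-lam 1)) := by
  exact ⟨degRep_germ_nonneg hφ hlam,
    -- The three Hermitian relations are blocks of a single identity on `D ⊕ D_•`.
    fun B η η' => germ_star_apply hφ hlam B (η, 0) (η', 0),
    fun B ζ η => germ_star_apply hφ hlam B (0, ζ) (η, 0),
    fun B ζ ζ' => germ_star_apply hφ hlam B (0, ζ) (0, ζ'),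
    neg_lam_one_nonneg_of_isSubfiltering hφ hlam,
    isNonneg_neg_lam_one_of_isContractive hφ hlam⟩
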